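/- **Theorem 4.1.** Let $M\in\{2,3\}$ and let $X\sim N_M(\mu,\Sigma)$, where $\mu\in\mathbb{R}^M$ is unknown and $\Sigma$ is a known positive definite intraclass covariance matrix, i.e. $\Sigma_{ii}=v$ for all $i$ and $\Sigma_{ij}=v\rho$ for all $i\neq j$. Consider the $M$ two-sided testing problems $H_i:\mu_i=0$ versus $K_i:\mu_i\neq 0$, $i=1,\dots,M$. Let $C_1>C_2>\dots>C_M$ be any real critical values. The likelihood-ratio step-down procedure LRSD is the following. At stage $m=1,\dots,M$ let $S_m\subseteq\{1,\dots,M\}$ be the set of coordinates not yet removed ($S_1=\{1,\dots,M\}$), let $x_{S_m}$ be the corresponding subvector of the observation $x$, and let $\Sigma_{S_m}$ be the corresponding submatrix of $\Sigma$. If $x_{S_m}'\Sigma_{S_m}^{-1}x_{S_m}<C_m$, stop and accept all $H_i$ with $i\in S_m$. Otherwise reject $H_{j_m}$, where $j_m\in S_m$ is the index with $|x_{j_m}|=\max_{j\in S_m}|x_j|$ (the smallest such index in case of ties, which have probability zero), and continue to stage $m+1$ with $S_{m+1}=S_m\setminus\{j_m\}$ (stop if $m=M$). Let $\phi_i(x)\in\{0,1\}$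 be the indicator that LRSD rejects $H_i$ when $x$ is observed. Then LRSD is admissible: for every $i\in\{1,\dots,M\}$, $\phi_i$ is a measurable test, and there is no measurable $\psi:\mathbb{R}^M\to[0,1]$ such that $E_\mu\psi(X)\le E_\mu\phi_i(X)$ for all $\mu$ with $\mu_i=0$ and $E_\mu\psi(X)\ge E_\mu\phi_i(X)$ for all $\mu$ with $\mu_i\neq 0$, with strict inequality for at least one $\mu\in\mathbb{R}^M$. -/

import Mathlib

open MeasureTheory ProbabilityTheory

noncomputable section

/-- A (possibly randomized) test on the sample space `X`: a measurable function with values in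
`[0, 1]`; `φ x` is the probability of rejecting when `x` is observed. -/
structure IsTest {X : Type*} [MeasurableSpace X] (φ : X → ℝ) : Prop where
  measurable : Measurable φ
  nonneg : ∀ x, 0 ≤ φ x
  le_one : ∀ x, φ x ≤ 1

open Classical in
/-- Risk function of the test `φ` of `θ ∈ H` against `θ ∉ H` under zero-one loss, for a family
`P θ` of laws: the probability of a type I error at `θ ∈ H`, of a type II error at `θ ∉ H`. -/
def testRisk {X Θ : Type*} [MeasurableSpace X] (P : Θ → Measure X) (H : Set Θ) (φ : X → ℝ)
    (θ : Θ) : ℝ :=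
  if θ ∈ H then ∫ x, φ x ∂(P θ) else 1 - ∫ x, φ x ∂(P θ)

/-- `φ` is an admissible test of `θ ∈ H` against `θ ∉ H`: it is a test, and no test has risk
nowhere larger and somewhere strictly smaller. -/
def IsAdmissibleTest {X Θ : Type*} [MeasurableSpace X] (P : Θ → Measure X) (H : Set Θ)
    (φ : X → ℝ) : Prop :=
  IsTest φ ∧ ¬ ∃ ψ : X → ℝ, IsTest ψ ∧
    (∀ θ, testRisk P H ψ θ ≤ testRisk P H φ θ) ∧ ∃ θ, testRisk P H ψ θ < testRisk P H φ θ

/-- A multiple testing procedure, given by its individual test functions `φ i`, is admissible for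
the two-sided problems `μ i = 0` against `μ i ≠ 0` about the mean vector of a normal vector with
known covariance matrix `V`, if each individual test is admissible for its own problem. The whole
mean vector is unknown. -/
def IsAdmissibleTwoSided {M : ℕ} (V : Matrix (Fin M) (Fin M) ℝ)
    (φ : Fin M → EuclideanSpace ℝ (Fin M) → ℝ) : Prop :=
  ∀ i, IsAdmissibleTest (fun μ : EuclideanSpace ℝ (Fin M) => multivariateGaussian μ V)
    {μ | μ i = 0} (φ i)

/-- The intraclass covariance matrix with common variance `v` and common correlation `ρ`. -/
def intraclassCov (M : ℕ) (v ρ : ℝ) : Matrix (Fin M) (Fin M) ℝ :=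
  Matrix.of fun i j => if i = j then v else v * ρ

/-- The likelihood ratio statistic `x_S' V_S⁻¹ x_S` of the global hypothesis `μ_S = 0` against
`μ_S ≠ 0`, based on the subvector `x_S` with covariance matrix `V_S`. -/
def lrStat {M : ℕ} (V : Matrix (Fin M) (Fin M) ℝ) (S : Finset (Fin M))
    (x : EuclideanSpace ℝ (Fin M)) : ℝ :=
  (fun i : S => x i) ⬝ᵥ
    ((V.submatrix (fun i : S => (i : Fin M)) (fun i : S => (i : Fin M)))⁻¹.mulVec
      (fun i : S => x i))

theorem maxAbs_nonempty {M : ℕ} (x : EuclideanSpace ℝ (Fin M)) (S : Finset (Fin M))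
    (h : S.Nonempty) : (S.filter fun j => ∀ k ∈ S, |x k| ≤ |x j|).Nonempty := by
  obtain ⟨j, hj, hmax⟩ := S.exists_max_image (fun j => |x j|) h
  exact ⟨j, Finset.mem_filter.2 ⟨hj, hmax⟩⟩

/-- The index in `S` at which `|x j|` is largest (the smallest such index in case of a tie). -/
def maxAbsIndex {M : ℕ} (x : EuclideanSpace ℝ (Fin M)) (S : Finset (Fin M))
    (h : S.Nonempty) : Fin M :=
  (S.filter fun j => ∀ k ∈ S, |x k| ≤ |x j|).min' (maxAbs_nonempty x S h)

/-- The hypotheses rejected by the likelihood ratio step-down method from the stage at which the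
coordinates in `S` remain and the list holds the critical values of this and the later stages:
if the global test for `S` rejects, then reject the hypothesis with the largest `|x j|`, remove
that coordinate and go to the next stage; otherwise stop and accept all that remain. -/
def lrsdRejectedFrom {M : ℕ} (V : Matrix (Fin M) (Fin M) ℝ) (x : EuclideanSpace ℝ (Fin M)) :
    List ℝ → Finset (Fin M) → Finset (Fin M)
  | [], _ => ∅
  | c :: cs, S =>
    open Classical in
    if h : S.Nonempty ∧ c ≤ lrStat V S x then
      insert (maxAbsIndex x S h.1) (lrsdRejectedFrom V x cs (S.erase (maxAbsIndex x S h.1)))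
    else ∅

/-- Test functions of the likelihood ratio step-down method with critical values
`C 0, C 1, …, C (M - 1)` at the successive stages: `1` if the `i`-th hypothesis is rejected. -/
def lrsdTest {M : ℕ} (V : Matrix (Fin M) (Fin M) ℝ) (C : Fin M → ℝ) (i : Fin M)
    (x : EuclideanSpace ℝ (Fin M)) : ℝ :=
  if i ∈ lrsdRejectedFrom V x (List.ofFn C) Finset.univ then 1 else 0

end

/-!
The natural parameter of the normal family is `η = V⁻¹ μ`, and `μ i = 0` means that `η` is
orthogonal to the `i`-th column `c` of `V`. Under this hypothesis the residual of `x` on `x i` is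
sufficient and complete, and its fibres are the lines in direction `c`.

*Sufficiency of interval sections* (`isAdmissibleTest_of_ordConnected`). Suppose that `φ` accepts
on an interval of every such line, and that `ψ` is nowhere worse. The difference of the power
functions, as a function of the mean `μ i`, is nonnegative off `0` and nonpositive at `0`, so it
has a zero with vanishing first and nonnegative second derivative there. By completeness
(`ae_eq_zero_of_integral_mul_exp_inner_eq_zero`), on almost every fibre the function `ψ - φ` has
vanishing integral and first moment. A polynomial of degree at most two, negative on the acceptance
interval and positive off it up to its endpoints, then shows that the second moment is nonpositive
on the fibre, and zero only if `ψ = φ` almost everywhere there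
(`second_moment_nonpos_of_ordConnected`). Integrated over the fibres the second
moment is the second derivative at `0`, hence nonnegative, and so `ψ = φ` almost everywhere.

*Sections of the step-down acceptance regions* (`notMem_lrsdRejectedFrom_shrink`). On a line in
direction `c` write `T` for the `i`-th coordinate; the others are `r j + ρ T`. The likelihood
ratio statistic of a set that contains `i` is a constant plus `T ^ 2 / v`, and `|T| ≤ |r j + ρ T|`
remains true, strictly, when `T` shrinks towards `0`, as `|ρ| < 1`. The acceptance section is then
star-shaped about `T = 0`: shrinking `T` keeps accepting, as long as the same coordinates are
removed first. If the first removal changes from `j` to `k` on the way, then `r j ^ 2 ≤ r k ^ 2`,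
because `(r j + ρ T) ^ 2 - (r k + ρ T) ^ 2` is affine in `T`, and so the statistic of the new
pair `{i, j}` does not exceed that of the old pair `{i, k}`.
-/

open scoped RealInnerProductSpace Topology

noncomputable section

/-! ### Uniqueness of Laplace transforms -/

section Laplace

variable {E : Type*} [NormedAddCommGroup E] [InnerProductSpace ℝ E] [MeasurableSpace E]
  [BorelSpace E] [SecondCountableTopology E] [CompleteSpace E]

/-- A finite measure with everywhere finite Laplace transform is determined by it: along every
direction the transform extends analytically to the imaginary axis, where it is the
characteristic function. -/
theorem ext_of_integral_exp_inner {μ ν : Measure E} [IsFiniteMeasure μ] [IsFiniteMeasure ν]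
    (hμ : ∀ η : E, Integrable (fun x => Real.exp ⟪η, x⟫) μ)
    (h : ∀ η : E, ∫ x, Real.exp ⟪η, x⟫ ∂μ = ∫ x, Real.exp ⟪η, x⟫ ∂ν) : μ = ν := by
  have hmgf : ∀ t : E, mgf (fun x => ⟪t, x⟫) μ = mgf (fun x => ⟪t, x⟫) ν := by
    intro t
    ext s
    simpa [mgf, real_inner_smul_left] using h (s • t)
  have hzero : μ = 0 ↔ ν = 0 := by
    have h0 : μ.real Set.univ = ν.real Set.univ := by simpa using h 0
    rw [← Measure.measure_univ_eq_zero, ← Measure.measure_univ_eq_zero,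
      ← measureReal_eq_zero_iff, ← measureReal_eq_zero_iff, h0]
  refine Measure.ext_of_charFun (funext fun t => ?_)
  have hI : integrableExpSet (fun x => ⟪t, x⟫) μ = Set.univ := by
    refine Set.eq_univ_of_forall fun s => ?_
    simpa [integrableExpSet, real_inner_smul_left] using hμ (s • t)
  have := eqOn_complexMGF_of_mgf' (hmgf t) hzero (x := Complex.I) (by simp [hI])
  simpa [charFun_apply, complexMGF, real_inner_comm, mul_comm] using this

/-- Completeness of an exponential family with full natural parameter space. -/
theorem ae_eq_zero_of_integral_mul_exp_inner_eq_zero {μ : Measure E} {K : E → ℝ}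
    (hK : Measurable K) (hint : ∀ η : E, Integrable (fun x => K x * Real.exp ⟪η, x⟫) μ)
    (h : ∀ η : E, ∫ x, K x * Real.exp ⟪η, x⟫ ∂μ = 0) : K =ᵐ[μ] 0 := by
  have hK1 : Integrable K μ := by simpa using hint 0
  have hp : ∀ η : E, Integrable (fun x => max (K x) 0 * Real.exp ⟪η, x⟫) μ := fun η => by
    refine (hint η).pos_part.congr (Filter.Eventually.of_forall fun x => ?_)
    simp [max_mul_of_nonneg _ _ (Real.exp_pos _).le]
  have hn : ∀ η : E, Integrable (fun x => max (-K x) 0 * Real.exp ⟪η, x⟫) μ := fun η => by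
    refine (hint η).neg_part.congr (Filter.Eventually.of_forall fun x => ?_)
    simp [max_mul_of_nonneg _ _ (Real.exp_pos _).le]
  have hmp : Measurable fun x => ENNReal.ofReal (K x) := by fun_prop
  have hmn : Measurable fun x => ENNReal.ofReal (-K x) := by fun_prop
  have : IsFiniteMeasure (μ.withDensity fun x => ENNReal.ofReal (K x)) :=
    isFiniteMeasure_withDensity_ofReal hK1.2
  have : IsFiniteMeasure (μ.withDensity fun x => ENNReal.ofReal (-K x)) :=
    isFiniteMeasure_withDensity_ofReal hK1.neg.2
  have heq : (μ.withDensity fun x => ENNReal.ofReal (K x))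
      = μ.withDensity fun x => ENNReal.ofReal (-K x) := by
    refine ext_of_integral_exp_inner (fun η => ?_) fun η => ?_
    · rw [integrable_withDensity_iff_integrable_smul' hmp (by simp)]
      simpa [ENNReal.toReal_ofReal'] using hp η
    · rw [integral_withDensity_eq_integral_toReal_smul hmp (by simp),
        integral_withDensity_eq_integral_toReal_smul hmn (by simp)]
      simp only [ENNReal.toReal_ofReal', smul_eq_mul]
      rw [← sub_eq_zero, ← integral_sub (hp η) (hn η)]
      simpa only [← sub_mul, max_zero_sub_max_neg_zero_eq_self] using h η
  have hfin : ∫⁻ x, ENNReal.ofReal (K x) ∂μ ≠ ⊤ := by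
    simpa using (measure_ne_top (μ.withDensity fun x => ENNReal.ofReal (K x)) Set.univ)
  filter_upwards [(withDensity_eq_iff hmp.aemeasurable hmn.aemeasurable hfin).1 heq] with x hx
  rcases le_total 0 (K x) with h0 | h0
  · rw [ENNReal.ofReal_of_nonpos (by linarith : -K x ≤ 0), ENNReal.ofReal_eq_zero] at hx
    exact le_antisymm hx h0
  · rw [ENNReal.ofReal_of_nonpos h0, eq_comm, ENNReal.ofReal_eq_zero] at hx
    exact le_antisymm h0 (neg_nonpos.1 hx)

end Laplace

/-! ### Moments and derivatives of exponential integrals -/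

section Derivative

variable {Ω : Type*} [MeasurableSpace Ω] {μ : Measure Ω} {g X : Ω → ℝ}

theorem integrable_and_hasDerivAt_integral_pow_mul_exp_of_nonneg (hg : Measurable g)
    (hg0 : ∀ ω, 0 ≤ g ω)
    (hint : ∀ s : ℝ, Integrable (fun ω => g ω * Real.exp (s * X ω)) μ) (n : ℕ) (s : ℝ) :
    Integrable (fun ω => g ω * (X ω ^ n * Real.exp (s * X ω))) μ ∧
    HasDerivAt (fun s => ∫ ω, g ω * (X ω ^ n * Real.exp (s * X ω)) ∂μ)
      (∫ ω, g ω * (X ω ^ (n + 1) * Real.exp (s * X ω)) ∂μ) s := by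
  have hm : Measurable fun ω => ENNReal.ofReal (g ω) := by fun_prop
  have hI : integrableExpSet X (μ.withDensity fun ω => ENNReal.ofReal (g ω)) = Set.univ := by
    refine Set.eq_univ_of_forall fun s => ?_
    rw [integrableExpSet, Set.mem_ofPred_eq,
      integrable_withDensity_iff_integrable_smul' hm (by simp)]
    simpa [ENNReal.toReal_ofReal, hg0] using hint s
  have hs : s ∈ interior (integrableExpSet X (μ.withDensity fun ω => ENNReal.ofReal (g ω))) := by
    simp [hI]
  constructor
  · have := integrable_pow_mul_exp_of_mem_interior_integrableExpSet hs n
    rw [integrable_withDensity_iff_integrable_smul' hm (by simp)] at this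
    simpa [ENNReal.toReal_ofReal, hg0] using this
  · have := hasDerivAt_integral_pow_mul_exp_real hs n
    simp only [integral_withDensity_eq_integral_toReal_smul hm
      (Filter.Eventually.of_forall fun ω => ENNReal.ofReal_lt_top),
      ENNReal.toReal_ofReal (hg0 _), smul_eq_mul] at this
    exact this

theorem integrable_and_hasDerivAt_integral_pow_mul_exp (hg : Measurable g)
    (hint : ∀ s : ℝ, Integrable (fun ω => g ω * Real.exp (s * X ω)) μ) (n : ℕ) (s : ℝ) :
    Integrable (fun ω => g ω * (X ω ^ n * Real.exp (s * X ω))) μ ∧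
    HasDerivAt (fun s => ∫ ω, g ω * (X ω ^ n * Real.exp (s * X ω)) ∂μ)
      (∫ ω, g ω * (X ω ^ (n + 1) * Real.exp (s * X ω)) ∂μ) s := by
  have hp := integrable_and_hasDerivAt_integral_pow_mul_exp_of_nonneg (μ := μ) (X := X)
    (g := fun ω => max (g ω) 0) (by fun_prop) (fun ω => le_max_right _ _) fun s => by
      refine (hint s).pos_part.congr (Filter.Eventually.of_forall fun x => ?_)
      simp [max_mul_of_nonneg _ _ (Real.exp_pos _).le]
  have hn := integrable_and_hasDerivAt_integral_pow_mul_exp_of_nonneg (μ := μ) (X := X)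
    (g := fun ω => max (-g ω) 0) (by fun_prop) (fun ω => le_max_right _ _) fun s => by
      refine (hint s).neg_part.congr (Filter.Eventually.of_forall fun x => ?_)
      simp [max_mul_of_nonneg _ _ (Real.exp_pos _).le]
  have hg' : ∀ n s, (fun ω => g ω * (X ω ^ n * Real.exp (s * X ω))) = fun ω =>
      max (g ω) 0 * (X ω ^ n * Real.exp (s * X ω))
        - max (-g ω) 0 * (X ω ^ n * Real.exp (s * X ω)) := fun n s => by
    ext ω
    rw [← sub_mul, max_zero_sub_max_neg_zero_eq_self]
  have hF : ∀ n s, ∫ ω, g ω * (X ω ^ n * Real.exp (s * X ω)) ∂μ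
      = ∫ ω, max (g ω) 0 * (X ω ^ n * Real.exp (s * X ω)) ∂μ
        - ∫ ω, max (-g ω) 0 * (X ω ^ n * Real.exp (s * X ω)) ∂μ := fun n s => by
    rw [hg' n s, integral_sub (hp n s).1 (hn n s).1]
  constructor
  · rw [hg' n s]
    exact (hp n s).1.sub (hn n s).1
  · simp only [hF]
    exact (hp n s).2.sub (hn n s).2

end Derivative

theorem derivatives_of_nonneg_off_zero {F F' : ℝ → ℝ} {F'' : ℝ}
    (hF : ∀ s, HasDerivAt F (F' s) s) (hF' : HasDerivAt F' F'' 0) (h0 : F 0 ≤ 0)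
    (hpos : ∀ s, s ≠ 0 → 0 ≤ F s) : F 0 = 0 ∧ F' 0 = 0 ∧ 0 ≤ F'' := by
  have hzero : F 0 = 0 := by
    refine le_antisymm h0 ?_
    have ht : Filter.Tendsto F (𝓝[≠] 0) (𝓝 (F 0)) :=
      (hF 0).continuousAt.tendsto.mono_left nhdsWithin_le_nhds
    refine ge_of_tendsto ht ?_
    filter_upwards [self_mem_nhdsWithin] with s hs using hpos s hs
  have hnn : ∀ s, 0 ≤ F s := fun s => by
    by_cases hs : s = 0
    · rw [hs, hzero]
    · exact hpos s hs
  have hd0 : F' 0 = 0 := by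
    refine IsLocalMin.hasDerivAt_eq_zero ?_ (hF 0)
    exact Filter.Eventually.of_forall fun s => by rw [hzero]; exact hnn s
  refine ⟨hzero, hd0, ?_⟩
  by_contra hneg
  have hdF : deriv F = F' := funext fun s => (hF s).deriv
  -- A negative second derivative would make `0` a local maximum, hence `F` locally zero.
  have hmax : IsLocalMax F 0 := isLocalMax_of_deriv_deriv_neg
    (by rw [hdF, hF'.deriv]; linarith) (by rw [hdF, hd0]) (hF 0).continuousAt
  have hloc : F =ᶠ[𝓝 0] fun _ => 0 := by
    filter_upwards [hmax] with s hs using le_antisymm (hs.trans h0) (hnn s)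
  have h1 : F' =ᶠ[𝓝 0] fun _ => 0 := by
    rw [← hdF]
    simpa using hloc.deriv
  have : F'' = 0 := by
    rw [← hF'.deriv, h1.deriv_eq, deriv_const]
  linarith

/-! ### Two-sided tests on the line -/

section Fibre

/-- An interval of the real line is, up to finitely many points, the set where some polynomial
`α + β t + γ t²` with `γ ≥ 0` is negative, and off it the polynomial is positive. Unbounded
intervals are the reason why `γ` may vanish. -/
theorem exists_quadratic_sign_of_ordConnected {A : Set ℝ} (hA : A.OrdConnected) :
    ∃ (α β γ : ℝ) (N : Set ℝ), 0 ≤ γ ∧ N.Finite ∧ ∀ t, t ∉ N →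
      (t ∈ A → α + β * t + γ * t ^ 2 < 0) ∧ (t ∉ A → 0 < α + β * t + γ * t ^ 2) := by
  rcases A.eq_empty_or_nonempty with rfl | hne
  · exact ⟨1, 0, 0, ∅, le_rfl, Set.finite_empty, by simp⟩
  by_cases hb : BddBelow A <;> by_cases ha : BddAbove A
  · refine ⟨sInf A * sSup A, -(sInf A + sSup A), 1, {sInf A, sSup A}, zero_le_one,
      by simp, fun t ht => ?_⟩
    simp only [Set.mem_insert_iff, Set.mem_singleton_iff, not_or] at ht
    have hq : sInf A * sSup A + -(sInf A + sSup A) * t + 1 * t ^ 2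
        = (t - sInf A) * (t - sSup A) := by ring
    rw [hq]
    have hle := csInf_le_csSup hne hb ha
    refine ⟨fun hmem => ?_, fun hmem => ?_⟩
    · have h1 := lt_of_le_of_ne (csInf_le hb hmem) (Ne.symm ht.1)
      have h2 := lt_of_le_of_ne (le_csSup ha hmem) ht.2
      exact mul_neg_of_pos_of_neg (by linarith) (by linarith)
    · rcases lt_or_gt_of_ne ht.1 with h1 | h1
      · exact mul_pos_of_neg_of_neg (by linarith) (by linarith)
      · rcases lt_or_gt_of_ne ht.2 with h2 | h2
        · obtain ⟨a, haA, hat⟩ := (csInf_lt_iff hb hne).1 h1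
          obtain ⟨b, hbA, hbt⟩ := (lt_csSup_iff ha hne).1 h2
          exact absurd (hA.out haA hbA ⟨hat.le, hbt.le⟩) hmem
        · exact mul_pos (by linarith) (by linarith)
  · refine ⟨sInf A, -1, 0, {sInf A}, le_rfl, by simp, fun t ht => ?_⟩
    simp only [Set.mem_singleton_iff] at ht
    refine ⟨fun hmem => ?_, fun hmem => ?_⟩
    · have h1 := lt_of_le_of_ne (csInf_le hb hmem) (Ne.symm ht)
      linarith
    · rcases lt_or_gt_of_ne ht with h1 | h1
      · linarith
      · obtain ⟨a, haA, hat⟩ := (csInf_lt_iff hb hne).1 h1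
        obtain ⟨b, hbA, hbt⟩ := not_bddAbove_iff.1 ha t
        exact absurd (hA.out haA hbA ⟨hat.le, hbt.le⟩) hmem
  · refine ⟨-sSup A, 1, 0, {sSup A}, le_rfl, by simp, fun t ht => ?_⟩
    simp only [Set.mem_singleton_iff] at ht
    refine ⟨fun hmem => ?_, fun hmem => ?_⟩
    · have h1 := lt_of_le_of_ne (le_csSup ha hmem) ht
      linarith
    · rcases lt_or_gt_of_ne ht with h1 | h1
      · obtain ⟨b, hbA, hbt⟩ := (lt_csSup_iff ha hne).1 h1
        obtain ⟨a, haA, hat⟩ := not_bddBelow_iff.1 hb t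
        exact absurd (hA.out haA hbA ⟨hat.le, hbt.le⟩) hmem
      · linarith
  · refine ⟨-1, 0, 0, ∅, le_rfl, Set.finite_empty, fun t _ => ?_⟩
    obtain ⟨a, haA, hat⟩ := not_bddBelow_iff.1 hb t
    obtain ⟨b, hbA, hbt⟩ := not_bddAbove_iff.1 ha t
    exact ⟨fun _ => by norm_num, fun hmem => absurd (hA.out haA hbA ⟨hat.le, hbt.le⟩) hmem⟩

/-- Two-sided tests on the line: a perturbation of the test with acceptance interval `A` that
preserves size and first moment lowers the second moment, unless it vanishes almost everywhere. The
quadratic polynomial that separates `A` from its complement is the Neyman-Pearson multiplier. -/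
theorem second_moment_nonpos_of_ordConnected {ν : Measure ℝ} [NullSingletonClass ν]
    {A : Set ℝ} (hA : A.OrdConnected) {h : ℝ → ℝ}
    (hin : ∀ t ∈ A, 0 ≤ h t) (hout : ∀ t, t ∉ A → h t ≤ 0) (h0 : Integrable h ν)
    (h1 : Integrable (fun t => h t * t) ν) (h2 : Integrable (fun t => h t * t ^ 2) ν)
    (hm0 : ∫ t, h t ∂ν = 0) (hm1 : ∫ t, h t * t ∂ν = 0) :
    ∫ t, h t * t ^ 2 ∂ν ≤ 0 ∧ (∫ t, h t * t ^ 2 ∂ν = 0 → h =ᵐ[ν] 0) := by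
  obtain ⟨α, β, γ, N, hγ, hN, hq⟩ := exists_quadratic_sign_of_ordConnected hA
  have hNae : ∀ᵐ t ∂ν, t ∉ N := by
    rw [ae_iff]; simpa using hN.measure_zero ν
  set q : ℝ → ℝ := fun t => α + β * t + γ * t ^ 2 with hqdef
  have hexp : (fun t => -(h t * q t))
      = fun t => -(α * h t + β * (h t * t) + γ * (h t * t ^ 2)) := by
    ext t; simp only [hqdef]; ring
  have hint : Integrable (fun t => -(h t * q t)) ν := by
    rw [hexp]
    exact (((h0.const_mul α).add (h1.const_mul β)).add (h2.const_mul γ)).neg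
  have hval : ∫ t, -(h t * q t) ∂ν = -(γ * ∫ t, h t * t ^ 2 ∂ν) := by
    have h01 : Integrable (fun t => α * h t + β * (h t * t)) ν :=
      (h0.const_mul α).add (h1.const_mul β)
    rw [hexp, integral_neg, integral_add h01 (h2.const_mul γ),
      integral_add (h0.const_mul α) (h1.const_mul β), integral_const_mul, integral_const_mul,
      integral_const_mul, hm0, hm1]
    ring
  have hnn : 0 ≤ᵐ[ν] fun t => -(h t * q t) := by
    filter_upwards [hNae] with t ht
    by_cases hmem : t ∈ A
    · exact neg_nonneg.2 (mul_nonpos_of_nonneg_of_nonpos (hin t hmem) ((hq t ht).1 hmem).le)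
    · exact neg_nonneg.2 (mul_nonpos_of_nonpos_of_nonneg (hout t hmem) ((hq t ht).2 hmem).le)
  have hzero : γ * ∫ t, h t * t ^ 2 ∂ν = 0 → h =ᵐ[ν] 0 := by
    intro hz
    have := (integral_eq_zero_iff_of_nonneg_ae hnn hint).1 (by rw [hval, hz, neg_zero])
    filter_upwards [this, hNae] with t ht htN
    have hq0 : q t ≠ 0 := by
      by_cases hmem : t ∈ A
      · exact ((hq t htN).1 hmem).ne
      · exact ((hq t htN).2 hmem).ne'
    simpa [hq0] using ht
  refine ⟨?_, fun hz => hzero (by rw [hz, mul_zero])⟩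
  rcases hγ.eq_or_lt with hγ0 | hγ0
  · rw [integral_congr_ae (g := fun _ => (0 : ℝ))]
    · simp
    · filter_upwards [hzero (by rw [← hγ0, zero_mul])] with t ht
      simp [ht]
  · have := integral_nonneg_of_ae hnn
    rw [hval] at this
    by_contra hc
    have := mul_pos hγ0 (not_le.1 hc)
    linarith

end Fibre

/-! ### Comparison of tests in an exponential family -/

section Product

variable {E : Type*} [NormedAddCommGroup E] [InnerProductSpace ℝ E] [MeasurableSpace E]
  [BorelSpace E] [SecondCountableTopology E] [CompleteSpace E]

/-- The heart of the admissibility argument, for a sample `(z, t)` from the exponential family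
with natural parameters `(η, s)` generated by `γ.prod ν`, and for the difference `h` of
two tests of `s = 0`. If the competitor has no larger size and no smaller power, then
the moments `∫ h`, `∫ h t` vanish and `∫ h t ^ 2 ≥ 0`; by completeness of `z` on `s = 0` the first
two vanish conditionally on `z`, and interval sections force `∫ h t ^ 2 ≤ 0` conditionally on `z`
with equality only for `h = 0`. -/
theorem ae_eq_zero_of_forall_integral_sign {γ : Measure E} [IsFiniteMeasure γ] {ν : Measure ℝ}
    [IsFiniteMeasure ν] [NullSingletonClass ν]
    (hγ : ∀ η : E, Integrable (fun z => Real.exp ⟪η, z⟫) γ)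
    (hν : ∀ s : ℝ, Integrable (fun t => Real.exp (s * t)) ν)
    {h : E × ℝ → ℝ} (hm : Measurable h) (hb : ∀ p, |h p| ≤ 1)
    {A : E → Set ℝ} (hA : ∀ z, (A z).OrdConnected) (hin : ∀ z, ∀ t ∈ A z, 0 ≤ h (z, t))
    (hout : ∀ z, ∀ t, t ∉ A z → h (z, t) ≤ 0)
    (hle : ∀ η : E, ∫ p, h p * Real.exp ⟪η, p.1⟫ ∂(γ.prod ν) ≤ 0)
    (hge : ∀ (η : E) (s : ℝ), s ≠ 0 →
      0 ≤ ∫ p, h p * (Real.exp ⟪η, p.1⟫ * Real.exp (s * p.2)) ∂(γ.prod ν)) :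
    h =ᵐ[γ.prod ν] 0 := by
  have hint : ∀ (η : E) (s : ℝ), Integrable
      (fun p : E × ℝ => h p * Real.exp ⟪η, p.1⟫ * Real.exp (s * p.2)) (γ.prod ν) := by
    intro η s
    simp only [mul_assoc]
    exact ((hγ η).mul_prod (hν s)).bdd_mul hm.aestronglyMeasurable
      (Filter.Eventually.of_forall hb)
  have hgm : ∀ η : E, Measurable fun p : E × ℝ => h p * Real.exp ⟪η, p.1⟫ := fun η => by
    fun_prop
  have hD := fun η => integrable_and_hasDerivAt_integral_pow_mul_exp (hgm η) (hint η)
  have hI : ∀ (η : E) (n : ℕ),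
      Integrable (fun p : E × ℝ => h p * p.2 ^ n * Real.exp ⟪η, p.1⟫) (γ.prod ν) := by
    intro η n
    refine (hD η n 0).1.congr (Filter.Eventually.of_forall fun p => ?_)
    simp only [zero_mul, Real.exp_zero, mul_one]; ring
  have hmom : ∀ η : E, ∫ p, h p * p.2 ^ 0 * Real.exp ⟪η, p.1⟫ ∂(γ.prod ν) = 0 ∧
      ∫ p, h p * p.2 ^ 1 * Real.exp ⟪η, p.1⟫ ∂(γ.prod ν) = 0 ∧
      0 ≤ ∫ p, h p * p.2 ^ 2 * Real.exp ⟪η, p.1⟫ ∂(γ.prod ν) := by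
    intro η
    have := derivatives_of_nonneg_off_zero (fun s => (hD η 0 s).2) (hD η 1 0).2
      (by simpa using hle η) (fun s hs => by simpa [mul_assoc] using hge η s hs)
    simpa [mul_right_comm] using this
  have hKm : ∀ n : ℕ, Measurable fun z => ∫ t, h (z, t) * t ^ n ∂ν := fun n => by
    have : Measurable fun p : E × ℝ => h p * p.2 ^ n := by fun_prop
    exact (this.stronglyMeasurable.integral_prod_right (ν := ν)).measurable
  have hKint : ∀ (n : ℕ) (η : E),
      Integrable (fun z => (∫ t, h (z, t) * t ^ n ∂ν) * Real.exp ⟪η, z⟫) γ := fun n η => by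
    simpa only [integral_mul_const] using (hI η n).integral_prod_left
  have hKval : ∀ (n : ℕ) (η : E), ∫ z, (∫ t, h (z, t) * t ^ n ∂ν) * Real.exp ⟪η, z⟫ ∂γ
      = ∫ p, h p * p.2 ^ n * Real.exp ⟪η, p.1⟫ ∂(γ.prod ν) := fun n η => by
    rw [integral_prod _ (hI η n)]
    simp only [integral_mul_const]
  have h0 := ae_eq_zero_of_integral_mul_exp_inner_eq_zero (hKm 0) (hKint 0)
    fun η => (hKval 0 η).trans (hmom η).1
  have h1 := ae_eq_zero_of_integral_mul_exp_inner_eq_zero (hKm 1) (hKint 1)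
    fun η => (hKval 1 η).trans (hmom η).2.1
  have hI' : ∀ n : ℕ, Integrable (fun p : E × ℝ => h p * p.2 ^ n) (γ.prod ν) := fun n => by
    simpa using hI 0 n
  have hfib : ∀ᵐ z ∂γ, ∫ t, h (z, t) * t ^ 2 ∂ν ≤ 0 ∧
      (∫ t, h (z, t) * t ^ 2 ∂ν = 0 → (fun t => h (z, t)) =ᵐ[ν] 0) := by
    filter_upwards [h0, h1, (hI' 0).prod_right_ae, (hI' 1).prod_right_ae, (hI' 2).prod_right_ae]
      with z hz0 hz1 hi0 hi1 hi2
    exact second_moment_nonpos_of_ordConnected (hA z) (hin z) (hout z) (by simpa using hi0)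
      (by simpa using hi1) hi2 (by simpa using hz0) (by simpa using hz1)
  have h2 : ∀ᵐ z ∂γ, -∫ t, h (z, t) * t ^ 2 ∂ν = 0 := by
    have hnn : 0 ≤ᵐ[γ] fun z => -∫ t, h (z, t) * t ^ 2 ∂ν := by
      filter_upwards [hfib] with z hz using neg_nonneg.2 hz.1
    have hi : Integrable (fun z => -∫ t, h (z, t) * t ^ 2 ∂ν) γ := by
      simpa using (hKint 2 0).neg
    refine (integral_eq_zero_iff_of_nonneg_ae hnn hi).1 (le_antisymm ?_ (integral_nonneg_of_ae hnn))
    rw [integral_neg, neg_nonpos]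
    have := (hmom 0).2.2
    rw [← hKval 2 0] at this
    simpa using this
  refine (Measure.ae_prod_iff_ae_ae (hm (measurableSet_singleton 0))).2 ?_
  filter_upwards [hfib, h2] with z hz hz2
  exact hz.2 (neg_eq_zero.1 hz2)

end Product

/-! ### Multivariate normal laws as an exponential family -/

section Gaussian

variable {ι : Type*} [Fintype ι] [DecidableEq ι] {V : Matrix ι ι ℝ}

theorem integrable_exp_inner_multivariateGaussian (μ η : EuclideanSpace ℝ ι) :
    Integrable (fun x => Real.exp ⟪η, x⟫) (multivariateGaussian μ V) := by
  have hmap := IsGaussian.map_eq_gaussianReal (μ := multivariateGaussian μ V) (innerSL ℝ η)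
  have := integrable_exp_mul_gaussianReal (μ := ∫ x, innerSL ℝ η x ∂(multivariateGaussian μ V))
    (v := Var[innerSL ℝ η; multivariateGaussian μ V].toNNReal) 1
  rw [← hmap, integrable_map_measure (by fun_prop) (by fun_prop)] at this
  simpa [Function.comp_def] using this

theorem integral_exp_inner_multivariateGaussian (hV : V.PosSemidef) (μ η : EuclideanSpace ℝ ι) :
    ∫ x, Real.exp ⟪η, x⟫ ∂(multivariateGaussian μ V)
      = Real.exp (⟪η, μ⟫ + η ⬝ᵥ V.mulVec η / 2) := by
  have hmap := IsGaussian.map_eq_gaussianReal (μ := multivariateGaussian μ V) (innerSL ℝ η)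
  have hmean : ∫ x, innerSL ℝ η x ∂(multivariateGaussian μ V) = ⟪η, μ⟫ := by
    rw [(innerSL ℝ η).integral_comp_id_comm IsGaussian.integrable_id]
    simp
  have hvar : Var[innerSL ℝ η; multivariateGaussian μ V] = η ⬝ᵥ V.mulVec η := by
    rw [← covarianceBilin_multivariateGaussian (μ := μ) hV,
      covarianceBilin_self IsGaussian.memLp_two_id]
    rfl
  have hnn : 0 ≤ η ⬝ᵥ V.mulVec η := by rw [← hvar]; exact variance_nonneg _ _
  have := mgf_gaussianReal hmap 1
  rw [hmean, hvar, Real.coe_toNNReal _ hnn] at this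
  simpa [mgf] using this

end Gaussian

section Regression

variable {ι : Type*} {V : Matrix ι ι ℝ}

/-- The `i`-th column of `V`. Among normal laws with covariance matrix `V`, it spans the
directions that are not seen by the sufficient statistic of the submodel `μ i = 0`. -/
def covColumn (V : Matrix ι ι ℝ) (i : ι) : EuclideanSpace ℝ ι := WithLp.toLp 2 fun j => V j i

/-- The residual of `x` after linear regression on its `i`-th coordinate; it is independent of
`x i` if `x` is normal with covariance matrix `V`. -/
def regressionResidual (V : Matrix ι ι ℝ) (i : ι) (x : EuclideanSpace ℝ ι) : EuclideanSpace ℝ ι :=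
  x - (x i / V i i) • covColumn V i

theorem regressionResidual_apply_self {i : ι} (hi : V i i ≠ 0) (x : EuclideanSpace ℝ ι) :
    regressionResidual V i x i = 0 := by
  simp [regressionResidual, covColumn, hi]

variable [Fintype ι]

theorem euclideanSpace_inner_eq_dotProduct (x y : EuclideanSpace ℝ ι) : ⟪x, y⟫ = x ⬝ᵥ y := by
  simp [PiLp.inner_apply, dotProduct, mul_comm]

theorem measurable_regressionResidual (i : ι) : Measurable (regressionResidual V i) := by
  unfold regressionResidual; fun_prop

theorem mulVec_apply_eq_inner_covColumn (hV : V.IsHermitian) (i : ι) (η : EuclideanSpace ℝ ι) :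
    V.mulVec η i = ⟪η, covColumn V i⟫ := by
  rw [euclideanSpace_inner_eq_dotProduct, dotProduct_comm]
  refine Finset.sum_congr rfl fun j _ => ?_
  exact congrArg (· * η j) (hV.apply i j).symm

variable [DecidableEq ι]

/-- Exponential tilting of a centred normal law shifts its mean, so that the normal laws with
covariance matrix `V` form an exponential family with natural parameter `V⁻¹ μ`. -/
theorem multivariateGaussian_eq_tilted (hV : V.PosSemidef) (η : EuclideanSpace ℝ ι) :
    multivariateGaussian (WithLp.toLp 2 (V.mulVec η)) V
      = (multivariateGaussian 0 V).tilted fun x => ⟪η, x⟫ := by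
  have hη := integrable_exp_inner_multivariateGaussian (V := V) 0 η
  have := isProbabilityMeasure_tilted hη
  refine ext_of_integral_exp_inner
    (fun s => integrable_exp_inner_multivariateGaussian _ s) fun s => ?_
  have hadd : ∀ x : EuclideanSpace ℝ ι,
      ((fun x => ⟪η, x⟫) + fun x => ⟪s, x⟫) x = ⟪η + s, x⟫ := fun x => by
    simp [inner_add_left]
  rw [integral_exp_tilted]
  simp only [hadd]
  rw [integral_exp_inner_multivariateGaussian hV, integral_exp_inner_multivariateGaussian hV,
    integral_exp_inner_multivariateGaussian hV, ← Real.exp_sub]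
  congr 1
  have hsymm : η.ofLp ⬝ᵥ V.mulVec s.ofLp = s.ofLp ⬝ᵥ V.mulVec η.ofLp := by
    rw [Matrix.dotProduct_mulVec, dotProduct_comm, ← Matrix.mulVec_transpose,
      ← Matrix.conjTranspose_eq_transpose_of_trivial, hV.isHermitian.eq]
  simp only [euclideanSpace_inner_eq_dotProduct, inner_zero_right, WithLp.ofLp_add,
    Matrix.mulVec_add, add_dotProduct, dotProduct_add, hsymm]
  ring

/-- Inner products with a residual are inner products with a vector orthogonal to the column. -/
theorem inner_regressionResidual (i : ι) (η x : EuclideanSpace ℝ ι) :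
    ⟪η, regressionResidual V i x⟫
      = ⟪η - (⟪η, covColumn V i⟫ / V i i) • EuclideanSpace.single i (1 : ℝ), x⟫ := by
  simp only [regressionResidual, inner_sub_right, inner_sub_left, inner_smul_left, inner_smul_right,
    EuclideanSpace.inner_single_left, map_one, one_mul, RCLike.conj_to_real]
  ring

/-- A centred normal vector is the sum of two independent parts: its residual on the `i`-th
coordinate and a normal multiple of the `i`-th column of the covariance matrix. -/
theorem map_regressionResidual_prod_gaussianReal (hV : V.PosDef) (i : ι) :
    (((multivariateGaussian 0 V).map (regressionResidual V i)).prod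
      (gaussianReal 0 (V i i)⁻¹.toNNReal)).map (fun p => p.1 + p.2 • covColumn V i)
      = multivariateGaussian 0 V := by
  have hi : 0 < V i i := hV.diag_pos
  have hprob : IsProbabilityMeasure ((multivariateGaussian 0 V).map (regressionResidual V i)) :=
    Measure.isProbabilityMeasure_map (measurable_regressionResidual i).aemeasurable
  have hmeas : Measurable fun p : EuclideanSpace ℝ ι × ℝ => p.1 + p.2 • covColumn V i := by
    fun_prop
  have : IsProbabilityMeasure ((((multivariateGaussian 0 V).map (regressionResidual V i)).prod
      (gaussianReal 0 (V i i)⁻¹.toNNReal)).map (fun p => p.1 + p.2 • covColumn V i)) :=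
    Measure.isProbabilityMeasure_map hmeas.aemeasurable
  symm
  refine ext_of_integral_exp_inner
    (fun s => integrable_exp_inner_multivariateGaussian _ s) fun η => ?_
  rw [integral_map hmeas.aemeasurable (by fun_prop)]
  simp only [inner_add_right, inner_smul_right, Real.exp_add, mul_comm _ ⟪η, covColumn V i⟫]
  rw [integral_prod_mul (fun z => Real.exp ⟪η, z⟫)
    (fun t => Real.exp (⟪η, covColumn V i⟫ * t)),
    integral_map (measurable_regressionResidual i).aemeasurable (by fun_prop)]
  simp only [inner_regressionResidual]
  have hmgf := mgf_gaussianReal (p := gaussianReal 0 (V i i)⁻¹.toNNReal) (X := id)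
    Measure.map_id ⟪η, covColumn V i⟫
  simp only [mgf, id] at hmgf
  rw [hmgf, integral_exp_inner_multivariateGaussian hV.posSemidef,
    integral_exp_inner_multivariateGaussian hV.posSemidef, ← Real.exp_add,
    Real.coe_toNNReal _ (inv_nonneg.2 hi.le)]
  congr 1
  set a := ⟪η, covColumn V i⟫ with ha
  have h1 : V.mulVec (Pi.single i 1) = (covColumn V i).ofLp := Matrix.mulVec_single_one V i
  have h2 : η.ofLp ⬝ᵥ (covColumn V i).ofLp = a := (euclideanSpace_inner_eq_dotProduct _ _).symm
  have h3 : V.mulVec η.ofLp i = a := mulVec_apply_eq_inner_covColumn hV.isHermitian i η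
  have h4 : (covColumn V i).ofLp i = V i i := rfl
  simp only [inner_zero_right, WithLp.ofLp_sub, WithLp.ofLp_smul, PiLp.ofLp_single,
    Matrix.mulVec_sub, Matrix.mulVec_smul, sub_dotProduct, dotProduct_sub, smul_dotProduct,
    dotProduct_smul, single_dotProduct, h1, h2, h3, h4, smul_eq_mul, one_mul]
  field_simp
  ring

end Regression

/-! ### Admissibility from interval sections -/

theorem IsTest.integrable {X : Type*} [MeasurableSpace X] {φ : X → ℝ} (hφ : IsTest φ)
    (P : Measure X) [IsFiniteMeasure P] : Integrable φ P :=
  Integrable.of_bound hφ.measurable.aestronglyMeasurable 1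
    (Filter.Eventually.of_forall fun x => by
      rw [Real.norm_of_nonneg (hφ.nonneg x)]; exact hφ.le_one x)

/-- A nonrandomized test of `μ i = 0` against `μ i ≠ 0` is admissible if its acceptance region
meets every line in the direction of the `i`-th column of the covariance matrix in an interval. -/
theorem isAdmissibleTest_of_ordConnected {M : ℕ} {V : Matrix (Fin M) (Fin M) ℝ} (hV : V.PosDef)
    (i : Fin M) {φ : EuclideanSpace ℝ (Fin M) → ℝ} (hφ : Measurable φ)
    (h01 : ∀ x, φ x = 0 ∨ φ x = 1)
    (hA : ∀ z, {t : ℝ | φ (z + t • covColumn V i) = 0}.OrdConnected) :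
    IsAdmissibleTest (fun μ : EuclideanSpace ℝ (Fin M) => multivariateGaussian μ V)
      {μ | μ i = 0} φ := by
  have hφt : IsTest φ := ⟨hφ, fun x => by rcases h01 x with h | h <;> simp [h],
    fun x => by rcases h01 x with h | h <;> simp [h]⟩
  refine ⟨hφt, ?_⟩
  rintro ⟨ψ, hψt, hrisk, θ, hθ⟩
  have hi : 0 < V i i := hV.diag_pos
  have hψ := hψt.measurable
  have hnull : ∀ μ : EuclideanSpace ℝ (Fin M), μ i = 0 →
      ∫ x, ψ x ∂(multivariateGaussian μ V) ≤ ∫ x, φ x ∂(multivariateGaussian μ V) :=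
    fun μ hμ => by simpa [testRisk, hμ] using hrisk μ
  have halt : ∀ μ : EuclideanSpace ℝ (Fin M), μ i ≠ 0 →
      ∫ x, φ x ∂(multivariateGaussian μ V) ≤ ∫ x, ψ x ∂(multivariateGaussian μ V) :=
    fun μ hμ => by
      have := hrisk μ
      simp only [testRisk, Set.mem_ofPred_eq, hμ, if_false] at this
      linarith
  suffices hae : ψ =ᵐ[multivariateGaussian 0 V] φ by
    -- All the normal laws are absolutely continuous with respect to the centred one.
    have hsurj : WithLp.toLp 2 (V.mulVec (V⁻¹.mulVec θ)) = θ := by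
      rw [Matrix.mulVec_mulVec, Matrix.mul_nonsing_inv _ hV.det_pos.ne'.isUnit, Matrix.one_mulVec]
    have htilt := multivariateGaussian_eq_tilted hV.posSemidef (WithLp.toLp 2 (V⁻¹.mulVec θ))
    simp only [hsurj] at htilt
    have hac : multivariateGaussian θ V ≪ multivariateGaussian 0 V := by
      rw [htilt]; exact tilted_absolutelyContinuous _ _
    have heq := integral_congr_ae (hac.ae_eq hae)
    simp [testRisk, heq] at hθ
  set c := covColumn V i with hc
  set γ := (multivariateGaussian 0 V).map (regressionResidual V i) with hγ
  set ν := gaussianReal 0 (V i i)⁻¹.toNNReal with hν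
  have hmap : (γ.prod ν).map (fun p => p.1 + p.2 • c) = multivariateGaussian 0 V :=
    map_regressionResidual_prod_gaussianReal hV i
  have hmeas : Measurable fun p : EuclideanSpace ℝ (Fin M) × ℝ => p.1 + p.2 • c := by fun_prop
  have hprob : IsProbabilityMeasure γ :=
    Measure.isProbabilityMeasure_map (measurable_regressionResidual i).aemeasurable
  have hatom : NullSingletonClass ν := nullSingletonClass_gaussianReal (by simpa using hi)
  have hzero : ∀ᵐ p ∂(γ.prod ν), p.1 i = 0 := by
    refine Measure.quasiMeasurePreserving_fst.ae
      (p := fun z : EuclideanSpace ℝ (Fin M) => z i = 0) ?_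
    rw [hγ, ae_map_iff (measurable_regressionResidual i).aemeasurable
      (measurableSet_eq_fun (by fun_prop) (by fun_prop))]
    exact Filter.Eventually.of_forall fun x => regressionResidual_apply_self hi.ne' x
  have hγexp : ∀ η : EuclideanSpace ℝ (Fin M), Integrable (fun z => Real.exp ⟪η, z⟫) γ := by
    intro η
    rw [hγ, integrable_map_measure (by fun_prop) (measurable_regressionResidual i).aemeasurable]
    simp only [Function.comp_def, inner_regressionResidual]
    exact integrable_exp_inner_multivariateGaussian _ _
  have hdiff : ∀ ξ : EuclideanSpace ℝ (Fin M),
      ∫ x, (ψ x - φ x) * Real.exp ⟪ξ, x⟫ ∂(multivariateGaussian 0 V)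
        = (∫ x, Real.exp ⟪ξ, x⟫ ∂(multivariateGaussian 0 V)) *
          (∫ x, ψ x ∂(multivariateGaussian (WithLp.toLp 2 (V.mulVec ξ)) V)
            - ∫ x, φ x ∂(multivariateGaussian (WithLp.toLp 2 (V.mulVec ξ)) V)) := by
    intro ξ
    have hpos := integral_exp_pos (integrable_exp_inner_multivariateGaussian (V := V) 0 ξ)
    rw [← integral_sub (hψt.integrable _) (hφt.integrable _),
      multivariateGaussian_eq_tilted hV.posSemidef, integral_tilted, ← integral_const_mul]
    congr 1 with x
    rw [smul_eq_mul]
    field_simp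
  -- The natural parameter for which the `i`-th mean is `s` and the residual has parameter `η`.
  have hnat : ∀ (η : EuclideanSpace ℝ (Fin M)) (s : ℝ), ∃ ξ : EuclideanSpace ℝ (Fin M),
      V.mulVec ξ i = s ∧ ∀ (z : EuclideanSpace ℝ (Fin M)) (t : ℝ), z i = 0 →
        ⟪ξ, z + t • c⟫ = ⟪η, z⟫ + s * t := by
    intro η s
    refine ⟨η + ((s - ⟪η, c⟫) / V i i) • EuclideanSpace.single i (1 : ℝ), ?_⟩
    have hci : c i = V i i := rfl
    have hs : ⟪η + ((s - ⟪η, c⟫) / V i i) • EuclideanSpace.single i (1 : ℝ), c⟫ = s := by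
      simp only [inner_add_left, inner_smul_left, EuclideanSpace.inner_single_left, map_one,
        one_mul, RCLike.conj_to_real, hci]
      field_simp
      ring
    refine ⟨by rw [mulVec_apply_eq_inner_covColumn hV.isHermitian, ← hc, hs], fun z t hz => ?_⟩
    rw [inner_add_right, inner_smul_right, hs]
    simp only [inner_add_left, inner_smul_left, EuclideanSpace.inner_single_left, map_one,
      one_mul, RCLike.conj_to_real, hz]
    ring
  have hint : ∀ (η : EuclideanSpace ℝ (Fin M)) (s : ℝ), ∃ ξ : EuclideanSpace ℝ (Fin M),
      V.mulVec ξ i = s ∧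
      ∫ p, (ψ (p.1 + p.2 • c) - φ (p.1 + p.2 • c)) *
        (Real.exp ⟪η, p.1⟫ * Real.exp (s * p.2)) ∂(γ.prod ν)
        = ∫ x, (ψ x - φ x) * Real.exp ⟪ξ, x⟫ ∂(multivariateGaussian 0 V) := by
    intro η s
    obtain ⟨ξ, hξ, hξ'⟩ := hnat η s
    refine ⟨ξ, hξ, ?_⟩
    rw [← hmap, integral_map hmeas.aemeasurable (by fun_prop)]
    refine integral_congr_ae ?_
    filter_upwards [hzero] with p hp
    rw [hξ' p.1 p.2 hp, Real.exp_add]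
  have hle0 : ∀ η : EuclideanSpace ℝ (Fin M),
      ∫ p, (ψ (p.1 + p.2 • c) - φ (p.1 + p.2 • c)) *
        Real.exp ⟪η, p.1⟫ ∂(γ.prod ν) ≤ 0 := by
    intro η
    obtain ⟨ξ, hξ, h⟩ := hint η 0
    simp only [zero_mul, Real.exp_zero, mul_one] at h
    rw [h, hdiff]
    exact mul_nonpos_of_nonneg_of_nonpos (integral_nonneg fun x => (Real.exp_pos _).le)
      (sub_nonpos.2 (hnull _ hξ))
  have hge0 : ∀ (η : EuclideanSpace ℝ (Fin M)) (s : ℝ), s ≠ 0 →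
      0 ≤ ∫ p, (ψ (p.1 + p.2 • c) - φ (p.1 + p.2 • c)) *
        (Real.exp ⟪η, p.1⟫ * Real.exp (s * p.2)) ∂(γ.prod ν) := by
    intro η s hs
    obtain ⟨ξ, hξ, h⟩ := hint η s
    rw [h, hdiff]
    exact mul_nonneg (integral_nonneg fun x => (Real.exp_pos _).le)
      (sub_nonneg.2 (halt _ (by rw [← hξ] at hs; exact hs)))
  have key := ae_eq_zero_of_forall_integral_sign hγexp
    (fun s => integrable_exp_mul_gaussianReal s)
    (h := fun p => ψ (p.1 + p.2 • c) - φ (p.1 + p.2 • c)) (by fun_prop)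
    (fun p => abs_le.2 ⟨by linarith [hψt.nonneg (p.1 + p.2 • c), hφt.le_one (p.1 + p.2 • c)],
      by linarith [hφt.nonneg (p.1 + p.2 • c), hψt.le_one (p.1 + p.2 • c)]⟩)
    (A := fun z => {t : ℝ | φ (z + t • c) = 0}) hA
    (fun z t (ht : φ (z + t • c) = 0) => by simpa [ht] using hψt.nonneg (z + t • c))
    (fun z t (ht : ¬ φ (z + t • c) = 0) => by
      simpa [(h01 _).resolve_left ht] using hψt.le_one (z + t • c))
    hle0 hge0
  rw [← hmap, Filter.EventuallyEq, ae_map_iff hmeas.aemeasurable (measurableSet_eq_fun hψ hφ)]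
  filter_upwards [key] with p hp
  exact sub_eq_zero.1 hp

/-! ### The step-down method -/

section StepDown

variable {M : ℕ} {V : Matrix (Fin M) (Fin M) ℝ}

theorem maxAbsIndex_mem (x : EuclideanSpace ℝ (Fin M)) {S : Finset (Fin M)} (h : S.Nonempty) :
    maxAbsIndex x S h ∈ S :=
  (Finset.mem_filter.1 (Finset.min'_mem _ (maxAbs_nonempty x S h))).1

theorem abs_le_abs_maxAbsIndex (x : EuclideanSpace ℝ (Fin M)) {S : Finset (Fin M)}
    (h : S.Nonempty) {k : Fin M} (hk : k ∈ S) : |x k| ≤ |x (maxAbsIndex x S h)| :=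
  (Finset.mem_filter.1 (Finset.min'_mem _ (maxAbs_nonempty x S h))).2 k hk

theorem maxAbsIndex_eq_iff (x : EuclideanSpace ℝ (Fin M)) {S : Finset (Fin M)} (h : S.Nonempty)
    (j : Fin M) : maxAbsIndex x S h = j ↔ (j ∈ S ∧ ∀ k ∈ S, |x k| ≤ |x j|) ∧
      ∀ l, (l ∈ S ∧ ∀ k ∈ S, |x k| ≤ |x l|) → j ≤ l := by
  simp only [maxAbsIndex, Finset.min'_eq_iff, Finset.mem_filter]

theorem mem_lrsdRejectedFrom_cons (x : EuclideanSpace ℝ (Fin M)) (c : ℝ) (cs : List ℝ)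
    {S : Finset (Fin M)} (h : S.Nonempty) (i : Fin M) :
    i ∈ lrsdRejectedFrom V x (c :: cs) S ↔ c ≤ lrStat V S x ∧
      (i = maxAbsIndex x S h ∨ i ∈ lrsdRejectedFrom V x cs (S.erase (maxAbsIndex x S h))) := by
  rw [lrsdRejectedFrom]
  by_cases hc : c ≤ lrStat V S x
  · simp [h, hc]
  · simp [hc]

theorem measurable_lrStat (S : Finset (Fin M)) : Measurable (lrStat V S) := by
  unfold lrStat
  simp only [dotProduct, Matrix.mulVec]
  fun_prop

theorem measurableSet_mem_lrsdRejectedFrom (i : Fin M) (l : List ℝ) (S : Finset (Fin M)) :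
    MeasurableSet {x | i ∈ lrsdRejectedFrom V x l S} := by
  induction l generalizing S with
  | nil => simp [lrsdRejectedFrom]
  | cons c cs ih =>
    by_cases h : S.Nonempty
    · have hset : {x | i ∈ lrsdRejectedFrom V x (c :: cs) S} = {x | c ≤ lrStat V S x} ∩
          ⋃ j, {x | maxAbsIndex x S h = j} ∩
            {x | i = j ∨ i ∈ lrsdRejectedFrom V x cs (S.erase j)} := by
        ext x
        simp [mem_lrsdRejectedFrom_cons x c cs h i]
      rw [hset]
      refine (measurableSet_le measurable_const (measurable_lrStat S)).inter
        (MeasurableSet.iUnion fun j => MeasurableSet.inter ?_ ?_)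
      · have hmax : ∀ l : Fin M, MeasurableSet {x : EuclideanSpace ℝ (Fin M) |
            l ∈ S ∧ ∀ k ∈ S, |x k| ≤ |x l|} := fun l => by
          have hinter : {x : EuclideanSpace ℝ (Fin M) | l ∈ S ∧ ∀ k ∈ S, |x k| ≤ |x l|}
              = {_x | l ∈ S} ∩ ⋂ k ∈ S, {x | |x k| ≤ |x l|} := by
            ext x; simp
          rw [hinter]
          exact (MeasurableSet.const _).inter (MeasurableSet.iInter fun k =>
            MeasurableSet.iInter fun _ => measurableSet_le (by fun_prop) (by fun_prop))
        have hindex : {x | maxAbsIndex x S h = j} = {x | j ∈ S ∧ ∀ k ∈ S, |x k| ≤ |x j|} ∩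
            ⋂ l, {x | l ∈ S ∧ ∀ k ∈ S, |x k| ≤ |x l|}ᶜ ∪ {_x | j ≤ l} := by
          ext x
          simp only [Set.mem_ofPred_eq, Set.mem_inter_iff, Set.mem_iInter, Set.mem_union,
            Set.mem_compl_iff, maxAbsIndex_eq_iff, imp_iff_not_or]
        rw [hindex]
        exact (hmax j).inter (MeasurableSet.iInter fun l =>
          (hmax l).compl.union (MeasurableSet.const _))
      · exact (MeasurableSet.const _).union (ih _)
    · simp [lrsdRejectedFrom, h]

theorem measurable_lrsdTest (C : Fin M → ℝ) (i : Fin M) : Measurable (lrsdTest V C i) :=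
  Measurable.ite (measurableSet_mem_lrsdRejectedFrom i _ _) measurable_const measurable_const

/-- Comparison of the last two stages of the step-down method at two sample points `x` and `y`,
when the rival of the `i`-th coordinate is `k` at `x` and `j` at `y`. The strict conclusion in
`hcross` makes the rule for ties at `y` irrelevant. -/
theorem notMem_lrsdRejectedFrom_pair {x y : EuclideanSpace ℝ (Fin M)} {i j k : Fin M}
    (hj : j ≠ i) (hk : k ≠ i) {c d : ℝ} (hpair : lrStat V {i, j} y ≤ lrStat V {i, k} x)
    (hsingle : lrStat V {i} y ≤ lrStat V {i} x) (hcross : |x i| ≤ |x k| → |y i| < |y j|)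
    (hx : i ∉ lrsdRejectedFrom V x [c, d] {i, k}) :
    i ∉ lrsdRejectedFrom V y [c, d] {i, j} := by
  have hnx : ({i, k} : Finset (Fin M)).Nonempty := ⟨i, by simp⟩
  have hny : ({i, j} : Finset (Fin M)).Nonempty := ⟨i, by simp⟩
  have hni : ({i} : Finset (Fin M)).Nonempty := ⟨i, by simp⟩
  rw [mem_lrsdRejectedFrom_cons _ _ _ hnx] at hx
  rw [mem_lrsdRejectedFrom_cons _ _ _ hny]
  rintro ⟨hc, hrej⟩
  replace hx := fun h => hx ⟨hc.trans hpair, h⟩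
  have hjx : maxAbsIndex x {i, k} hnx = k := by
    have := maxAbsIndex_mem x hnx
    simp only [Finset.mem_insert, Finset.mem_singleton] at this
    exact this.resolve_left fun h => hx (Or.inl h.symm)
  have hxk : |x i| ≤ |x k| := by
    have := abs_le_abs_maxAbsIndex x hnx (k := i) (by simp)
    rwa [hjx] at this
  have hjy : maxAbsIndex y {i, j} hny = j := by
    have := maxAbsIndex_mem y hny
    simp only [Finset.mem_insert, Finset.mem_singleton] at this
    refine this.resolve_left fun h => ?_
    have hle := abs_le_abs_maxAbsIndex y hny (k := j) (by simp)
    rw [h] at hle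
    exact absurd (hcross hxk) (not_lt.2 hle)
  have hex : ({i, k} : Finset (Fin M)).erase k = {i} := by
    ext l; simp only [Finset.mem_erase, Finset.mem_insert, Finset.mem_singleton]
    exact ⟨fun h => h.2.resolve_right h.1, fun h => ⟨h ▸ hk.symm, Or.inl h⟩⟩
  have hey : ({i, j} : Finset (Fin M)).erase j = {i} := by
    ext l; simp only [Finset.mem_erase, Finset.mem_insert, Finset.mem_singleton]
    exact ⟨fun h => h.2.resolve_right h.1, fun h => ⟨h ▸ hj.symm, Or.inl h⟩⟩
  rw [hjy, hey] at hrej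
  rw [hjx, hex] at hx
  have hmem : i ∈ lrsdRejectedFrom V y [d] {i} := hrej.resolve_left hj.symm
  have hself : ∀ z : EuclideanSpace ℝ (Fin M), i = maxAbsIndex z {i} hni := fun z =>
    (Finset.mem_singleton.1 (maxAbsIndex_mem z hni)).symm
  refine hx (Or.inr ?_)
  rw [mem_lrsdRejectedFrom_cons _ _ _ hni] at hmem ⊢
  exact ⟨hmem.1.trans hsingle, Or.inl (hself x)⟩

/-- Comparison of the three stages of the step-down method for three hypotheses at two sample
points. The last two stages at `x` and at `y` may be about different pairs of coordinates. -/
theorem notMem_lrsdRejectedFrom_univ_three {V : Matrix (Fin 3) (Fin 3) ℝ}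
    {x y : EuclideanSpace ℝ (Fin 3)} {i : Fin 3} {b c d : ℝ}
    (huniv : lrStat V Finset.univ y ≤ lrStat V Finset.univ x)
    (hpair : ∀ j k, j ≠ i → k ≠ i → (j = k ∨ (|x k| ≤ |x j| ∧ |y j| ≤ |y k|)) →
      lrStat V {i, j} y ≤ lrStat V {i, k} x)
    (hsingle : lrStat V {i} y ≤ lrStat V {i} x)
    (hcross : ∀ j, j ≠ i → |x i| ≤ |x j| → |y i| < |y j|)
    (hx : i ∉ lrsdRejectedFrom V x [b, c, d] Finset.univ) :
    i ∉ lrsdRejectedFrom V y [b, c, d] Finset.univ := by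
  have hn : (Finset.univ : Finset (Fin 3)).Nonempty := Finset.univ_nonempty
  rw [mem_lrsdRejectedFrom_cons _ _ _ hn] at hx ⊢
  rintro ⟨hb, hrej⟩
  replace hx := fun h => hx ⟨hb.trans huniv, h⟩
  have hmaxx : ∀ l, |x l| ≤ |x (maxAbsIndex x Finset.univ hn)| :=
    fun l => abs_le_abs_maxAbsIndex x hn (Finset.mem_univ l)
  have hmaxy : ∀ l, |y l| ≤ |y (maxAbsIndex y Finset.univ hn)| :=
    fun l => abs_le_abs_maxAbsIndex y hn (Finset.mem_univ l)
  generalize maxAbsIndex x Finset.univ hn = p at hx hmaxx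
  generalize maxAbsIndex y Finset.univ hn = q at hrej hmaxy
  have hp : p ≠ i := fun h => hx (Or.inl h.symm)
  have hq : q ≠ i := fun h => by
    have := hcross p hp (hmaxx i)
    rw [← h] at this
    exact absurd (hmaxy p) (not_le.2 this)
  replace hrej := hrej.resolve_left hq.symm
  replace hx := fun h => hx (Or.inr h)
  by_cases hpq : p = q
  · subst hpq
    obtain ⟨k, hk, hek⟩ : ∃ k, k ≠ i ∧ Finset.univ.erase p = {i, k} := by
      clear * - hp; revert i p; decide
    rw [hek] at hx hrej
    exact notMem_lrsdRejectedFrom_pair hk hk (hpair k k hk hk (Or.inl rfl)) hsingle (hcross k hk)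
      hx hrej
  · have hex : Finset.univ.erase p = {i, q} := by
      clear * - hp hq hpq; revert i p q; decide
    have hey : Finset.univ.erase q = {i, p} := by
      clear * - hp hq hpq; revert i p q; decide
    rw [hex] at hx
    rw [hey] at hrej
    exact notMem_lrsdRejectedFrom_pair hp hq (hpair p q hp hq (Or.inr ⟨hmaxx q, hmaxy p⟩)) hsingle
      (fun _ => hcross p hp (hmaxx i)) hx hrej

end StepDown

/-! ### Likelihood ratio statistics -/

section Statistic

variable {M : ℕ} {V : Matrix (Fin M) (Fin M) ℝ}

theorem posDef_submatrix_subtype (hV : V.PosDef) (S : Finset (Fin M)) :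
    (V.submatrix (fun i : S => (i : Fin M)) (fun i : S => (i : Fin M))).PosDef :=
  hV.submatrix Subtype.val_injective

theorem lrStat_eq_sum (hV : V.PosDef) {S : Finset (Fin M)} {x : EuclideanSpace ℝ (Fin M)}
    (y : Fin M → ℝ) (hy : ∀ j ∈ S, ∑ k ∈ S, V j k * y k = x j) :
    lrStat V S x = ∑ k ∈ S, x k * y k := by
  have hW := posDef_submatrix_subtype hV S
  have hsolve : (V.submatrix (fun i : S => (i : Fin M)) (fun i : S => (i : Fin M))).mulVec
      (fun k : S => y k) = fun k : S => x k := by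
    ext j
    rw [← hy j j.2, ← Finset.sum_coe_sort]
    rfl
  rw [lrStat, ← hsolve, Matrix.mulVec_mulVec, Matrix.nonsing_inv_mul _ hW.det_pos.ne'.isUnit,
    Matrix.one_mulVec, hsolve, ← Finset.sum_coe_sort]
  rfl

/-- Along the direction of the `i`-th column of the covariance matrix the likelihood ratio
statistics of the sets that contain `i` are centred parabolas in the `i`-th coordinate. -/
theorem lrStat_add_smul_covColumn (hV : V.PosDef) {S : Finset (Fin M)} {i : Fin M} (hi : i ∈ S)
    {r : EuclideanSpace ℝ (Fin M)} (hr : r i = 0) (t : ℝ) :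
    lrStat V S (r + t • covColumn V i) = V i i * t ^ 2 + lrStat V S r := by
  have hW := posDef_submatrix_subtype hV S
  set W := V.submatrix (fun i : S => (i : Fin M)) (fun i : S => (i : Fin M)) with hWdef
  have hu : IsUnit W.det := hW.det_pos.ne'.isUnit
  set e : S → ℝ := Pi.single ⟨i, hi⟩ 1 with he
  set u : S → ℝ := fun j => r j with hudef
  have hx : (fun j : S => (r + t • covColumn V i) j) = u + t • W.mulVec e := by
    ext j
    rw [he, Matrix.mulVec_single_one]
    simp [hudef, covColumn, hWdef]
  have hue : u ⬝ᵥ e = 0 := by simp [he, hudef, hr]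
  have hee : W.mulVec e ⬝ᵥ e = V i i := by
    rw [he, Matrix.mulVec_single_one]
    simp [hWdef]
  have hWu : W.mulVec e ⬝ᵥ W⁻¹.mulVec u = 0 := by
    rw [dotProduct_comm, Matrix.dotProduct_mulVec, ← Matrix.mulVec_transpose,
      ← Matrix.conjTranspose_eq_transpose_of_trivial, hW.isHermitian.eq, Matrix.mulVec_mulVec,
      Matrix.mul_nonsing_inv _ hu, Matrix.one_mulVec, hue]
  rw [lrStat, lrStat, hx, ← hWdef, Matrix.mulVec_add, Matrix.mulVec_smul, Matrix.mulVec_mulVec,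
    Matrix.nonsing_inv_mul _ hu, Matrix.one_mulVec]
  simp only [add_dotProduct, dotProduct_add, smul_dotProduct, dotProduct_smul, hue, hee, hWu,
    smul_eq_mul]
  ring

theorem intraclassCov_apply_self (v ρ : ℝ) (i : Fin M) : intraclassCov M v ρ i i = v := by
  simp [intraclassCov]

theorem intraclassCov_apply_ne (v ρ : ℝ) {i j : Fin M} (h : i ≠ j) :
    intraclassCov M v ρ i j = v * ρ := by
  simp [intraclassCov, h]

theorem abs_lt_one_of_posDef_intraclassCov {v ρ : ℝ} (hV : (intraclassCov M v ρ).PosDef)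
    {i j : Fin M} (hij : i ≠ j) : |ρ| < 1 := by
  have hv : 0 < v := by simpa [intraclassCov_apply_self] using hV.diag_pos (i := i)
  have hdet := (hV.submatrix (e := ![i, j]) (by
    intro a b; fin_cases a <;> fin_cases b <;> simp [hij, hij.symm])).det_pos
  rw [Matrix.det_fin_two] at hdet
  simp only [Matrix.submatrix_apply, Matrix.cons_val_zero, Matrix.cons_val_one,
    intraclassCov_apply_self, intraclassCov_apply_ne v ρ hij,
    intraclassCov_apply_ne v ρ hij.symm] at hdet
  rw [← sq_lt_one_iff_abs_lt_one]
  by_contra hc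
  have := mul_le_mul_of_nonneg_left (not_lt.1 hc) (mul_self_nonneg v)
  linarith

theorem lrStat_intraclassCov_pair {v ρ : ℝ} (hV : (intraclassCov M v ρ).PosDef) {i k : Fin M}
    (hk : k ≠ i) {r : EuclideanSpace ℝ (Fin M)} (hr : r i = 0) :
    lrStat (intraclassCov M v ρ) {i, k} r = r k ^ 2 / (v * (1 - ρ ^ 2)) := by
  have hv : v ≠ 0 := by
    simpa [intraclassCov_apply_self] using (hV.diag_pos (i := i)).ne'
  have hρ : 1 - ρ ^ 2 ≠ 0 := by
    have := (sq_lt_one_iff_abs_lt_one ρ).2 (abs_lt_one_of_posDef_intraclassCov hV hk)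
    linarith
  -- The vector below solves `V_S y = r_S` for `S = {i, k}`.
  rw [lrStat_eq_sum hV (fun l => (if l = i then -ρ else 1) * r k / (v * (1 - ρ ^ 2)))]
  · rw [Finset.sum_pair hk.symm, hr]
    simp only [hk, if_false]
    ring
  · intro j hj
    rw [Finset.sum_pair hk.symm]
    rcases Finset.mem_insert.1 hj with rfl | hj
    · rw [intraclassCov_apply_self, intraclassCov_apply_ne v ρ hk.symm, hr]
      simp only [hk, if_false, if_true]
      ring
    · rw [Finset.mem_singleton.1 hj, intraclassCov_apply_self, intraclassCov_apply_ne v ρ hk]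
      simp only [hk, if_false, if_true]
      field_simp
      ring

end Statistic

/-! ### Shape of the acceptance regions -/

section Geometry

/-- If `|T| ≤ |R + ρ T|` with `|ρ| < 1`, the inequality is strict closer to the origin. -/
theorem abs_lt_abs_add_of_shrink {ρ R T a : ℝ} (hρ : |ρ| < 1) (hT : T ≠ 0) (ha0 : 0 ≤ a)
    (ha1 : a < 1) (h : |T| ≤ |R + T * ρ|) : |a * T| < |R + a * T * ρ| := by
  have htri : |R + T * ρ| ≤ |R + a * T * ρ| + |(1 - a) * T * ρ| := by
    rw [show R + T * ρ = (R + a * T * ρ) + (1 - a) * T * ρ by ring]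
    exact abs_add_le _ _
  rw [abs_mul ((1 - a) * T), abs_mul (1 - a), abs_of_pos (sub_pos.2 ha1)] at htri
  rw [abs_mul, abs_of_nonneg ha0]
  have hpos : 0 < (1 - a) * |T| := mul_pos (sub_pos.2 ha1) (abs_pos.2 hT)
  have := mul_lt_of_lt_one_right hpos hρ
  linarith

/-- The difference of the squares of `R + T ρ` and `R' + T ρ` is affine in `T`, so its sign at the
origin is determined by opposite signs at two points on the same side of the origin. -/
theorem sq_le_sq_of_abs_le_of_shrink {ρ R R' T a : ℝ} (ha0 : 0 ≤ a) (ha1 : a < 1)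
    (h1 : |R' + T * ρ| ≤ |R + T * ρ|) (h2 : |R + a * T * ρ| ≤ |R' + a * T * ρ|) :
    R ^ 2 ≤ R' ^ 2 := by
  have h1' := mul_le_mul_of_nonneg_left (sq_le_sq.2 h1) ha0
  have h2' := sq_le_sq.2 h2
  have : (1 - a) * R ^ 2 ≤ (1 - a) * R' ^ 2 := by linarith
  exact le_of_mul_le_mul_left this (sub_pos.2 ha1)

/-- For at most three hypotheses with intraclass covariance matrix, the acceptance region of the
`i`-th hypothesis is star-shaped about the point of the line with vanishing `i`-th coordinate. -/
theorem notMem_lrsdRejectedFrom_shrink {M : ℕ} (hM : M = 2 ∨ M = 3) {v ρ : ℝ}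
    (hV : (intraclassCov M v ρ).PosDef) (C : Fin M → ℝ) {i : Fin M}
    {r : EuclideanSpace ℝ (Fin M)} (hr : r i = 0) {t a : ℝ} (ha0 : 0 ≤ a) (ha1 : a ≤ 1)
    (h : i ∉ lrsdRejectedFrom (intraclassCov M v ρ)
      (r + t • covColumn (intraclassCov M v ρ) i) (List.ofFn C) Finset.univ) :
    i ∉ lrsdRejectedFrom (intraclassCov M v ρ)
      (r + (a * t) • covColumn (intraclassCov M v ρ) i) (List.ofFn C) Finset.univ := by
  rcases eq_or_ne t 0 with rfl | ht
  · simpa using h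
  rcases ha1.eq_or_lt with rfl | ha1
  · simpa using h
  have hv : 0 < v := by simpa [intraclassCov_apply_self] using hV.diag_pos (i := i)
  have hci : ∀ s : ℝ, (r + s • covColumn (intraclassCov M v ρ) i) i = s * v := fun s => by
    simp [covColumn, intraclassCov_apply_self, hr]
  have hcj : ∀ (s : ℝ) (j : Fin M), j ≠ i →
      (r + s • covColumn (intraclassCov M v ρ) i) j = r j + s * v * ρ := fun s j hj => by
    simp [covColumn, intraclassCov_apply_ne v ρ hj, mul_assoc]
  have hsq : v * (a * t) ^ 2 ≤ v * t ^ 2 := by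
    rw [mul_pow]
    exact mul_le_mul_of_nonneg_left
      (mul_le_of_le_one_left (sq_nonneg t) (pow_le_one₀ ha0 ha1.le)) hv.le
  have hmono : ∀ S : Finset (Fin M), i ∈ S →
      lrStat (intraclassCov M v ρ) S (r + (a * t) • covColumn (intraclassCov M v ρ) i)
        ≤ lrStat (intraclassCov M v ρ) S (r + t • covColumn (intraclassCov M v ρ) i) := by
    intro S hS
    rw [lrStat_add_smul_covColumn hV hS hr, lrStat_add_smul_covColumn hV hS hr,
      intraclassCov_apply_self]
    linarith
  have hcross : ∀ j, j ≠ i →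
      |(r + t • covColumn (intraclassCov M v ρ) i) i|
        ≤ |(r + t • covColumn (intraclassCov M v ρ) i) j| →
      |(r + (a * t) • covColumn (intraclassCov M v ρ) i) i|
        < |(r + (a * t) • covColumn (intraclassCov M v ρ) i) j| := by
    intro j hj hle
    rw [hci, hcj _ j hj] at hle ⊢
    rw [mul_assoc a t v]
    exact abs_lt_abs_add_of_shrink (abs_lt_one_of_posDef_intraclassCov hV hj)
      (mul_ne_zero ht hv.ne') ha0 ha1 hle
  rcases hM with rfl | rfl
  · obtain ⟨k, hk, huniv⟩ : ∃ k, k ≠ i ∧ (Finset.univ : Finset (Fin 2)) = {i, k} := by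
      clear * -; revert i; decide
    have hC : List.ofFn C = [C 0, C 1] := by simp [List.ofFn_succ]
    rw [hC, huniv] at h ⊢
    exact notMem_lrsdRejectedFrom_pair hk hk (hmono _ (by simp)) (hmono _ (by simp))
      (hcross k hk) h
  · have hC : List.ofFn C = [C 0, C 1, C 2] := by simp [List.ofFn_succ]
    rw [hC] at h ⊢
    refine notMem_lrsdRejectedFrom_univ_three (hmono _ (by simp)) ?_ (hmono _ (by simp)) hcross h
    rintro j k hj hk (rfl | ⟨h1, h2⟩)
    · exact hmono _ (by simp)
    · rw [hcj _ j hj, hcj _ k hk] at h1 h2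
      rw [mul_assoc a t v] at h2
      have hjk := sq_le_sq_of_abs_le_of_shrink ha0 ha1 h1 h2
      rw [lrStat_add_smul_covColumn hV (by simp) hr, lrStat_add_smul_covColumn hV (by simp) hr,
        lrStat_intraclassCov_pair hV hj hr, lrStat_intraclassCov_pair hV hk hr,
        intraclassCov_apply_self]
      have hρ := (sq_lt_one_iff_abs_lt_one ρ).2 (abs_lt_one_of_posDef_intraclassCov hV hj)
      have hD : 0 ≤ v * (1 - ρ ^ 2) := mul_nonneg hv.le (by linarith)
      exact add_le_add hsq (div_le_div_of_nonneg_right hjk hD)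

end Geometry

end

theorem theorem4p1 (M : ℕ) (hM : M = 2 ∨ M = 3) (v ρ : ℝ)
    (hV : (intraclassCov M v ρ).PosDef) (C : Fin M → ℝ) (hC : StrictAnti C) :
    IsAdmissibleTwoSided (intraclassCov M v ρ) (lrsdTest (intraclassCov M v ρ) C) := by
  intro i
  refine isAdmissibleTest_of_ordConnected hV i (measurable_lrsdTest C i)
    (fun x => by unfold lrsdTest; split_ifs <;> simp) fun z => ?_
  have hi : intraclassCov M v ρ i i ≠ 0 := (hV.diag_pos (i := i)).ne'
  have hacc : ∀ t : ℝ,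
      lrsdTest (intraclassCov M v ρ) C i (z + t • covColumn (intraclassCov M v ρ) i) = 0 ↔
      i ∉ lrsdRejectedFrom (intraclassCov M v ρ) (regressionResidual (intraclassCov M v ρ) i z
        + (z i / intraclassCov M v ρ i i + t) • covColumn (intraclassCov M v ρ) i)
        (List.ofFn C) Finset.univ := by
    intro t
    have hz : regressionResidual (intraclassCov M v ρ) i z
        + (z i / intraclassCov M v ρ i i + t) • covColumn (intraclassCov M v ρ) i
        = z + t • covColumn (intraclassCov M v ρ) i := by
      rw [regressionResidual, add_smul]; abel
    rw [hz, lrsdTest]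
    split_ifs with hmem <;> simp [hmem]
  have hr := regressionResidual_apply_self hi z
  refine ⟨fun t₁ h₁ t₂ h₂ t ht => ?_⟩
  rw [Set.mem_ofPred_eq, hacc] at h₁ h₂ ⊢
  set b := z i / intraclassCov M v ρ i i with hb
  -- Shrink from the end of `[t₁, t₂]` that lies beyond `t`, seen from the centre `-b`.
  rcases le_total 0 (b + t) with hs | hs
  · have hle : b + t ≤ b + t₂ := by linarith [ht.2]
    have := notMem_lrsdRejectedFrom_shrink hM hV C hr (div_nonneg hs (hs.trans hle))
      (div_le_one_of_le₀ hle (hs.trans hle)) h₂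
    rwa [div_mul_cancel_of_imp fun h0 => le_antisymm (hle.trans h0.le) hs] at this
  · have hle : b + t₁ ≤ b + t := by linarith [ht.1]
    have := notMem_lrsdRejectedFrom_shrink hM hV C hr
      (div_nonneg_of_nonpos hs (hle.trans hs)) (div_le_one_of_ge hle (hle.trans hs)) h₁
    rwa [div_mul_cancel_of_imp fun h0 => le_antisymm hs (h0.ge.trans hle)] at this
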